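/- For a finite family of points $v_1,\dots,v_N\in\mathbb R^2$ put $$P(v_1,\dots,v_N)=\int_{\mathbb R^2}\max_i e^{-|x-v_i|^2}\,dx .$$ For a measurable density $f:\mathbb R^2\to[0,\infty]$ put $$P_f(v_1,\dots,v_N)=\int_{\mathbb R^2}\max_i f(x-v_i)\,dx,\qquad P^{\mathrm{Vor}}_f(v_1,\dots,v_N)=\sum_{p\in\{v_1,\dots,v_N\}}\int_{V_p} f(x-p)\,dx ,$$ where the sum is over the distinct points $p$ of the configuration and $V_p=\{x:|x-p|\le|x-v_i|\text{ for all }i\}$ is the Voronoi region of $p$. We write $P(\pm v_1,\pm v_2)=P(v_1,-v_1,v_2,-v_2)$, and similarly for $P_f$ and $P^{\mathrm{Vor}}_f$. **Theorem.** Let $v_1,v_2\in\mathbb R^2$ be orthogonal and of equal length, and let $E=|v_1|^2+|v_2|^2$. 1. Among all pairs $w_1,w_2\in\mathbb R^2$ with $|w_1|^2+|w_2|^2=E$, the value $P(\pm w_1,\pm w_2)$ is maximal at $(w_1,w_2)=(v_1,v_2)$. 2. The same holds for $P_f$ and for $P^{\mathrm{Vor}}_f$ whenever $f$ is a radially symmetric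 density that is nonincreasing in $|x|$. 3. For an arbitrary radially symmetric density $f$ (not necessarily monotone), $P^{\mathrm{Vor}}_f(\pm w_1,\pm w_2)$ is maximal at $(w_1,w_2)=(v_1,v_2)$ among all orthogonal pairs $w_1,w_2\in\mathbb R^2$ with $|w_1|^2+|w_2|^2=E$. -/

import Mathlib

open MeasureTheory
open scoped ENNReal

/-- `P(v₁, …, v_N) = ∫_{ℝⁿ} max_i exp(-|x - v_i|²) dx`. -/
noncomputable def gaussianP {n N : ℕ} (v : Fin N → EuclideanSpace ℝ (Fin n)) : ℝ :=
  ∫ x, ⨆ i, Real.exp (-‖x - v i‖ ^ 2)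

/-- The same functional with a density `f` in place of `exp(-|x|²)`:
`∫_{ℝⁿ} max_i f(x - v_i) dx`. -/
noncomputable def densityP {n N : ℕ} (f : EuclideanSpace ℝ (Fin n) → ℝ≥0∞)
    (v : Fin N → EuclideanSpace ℝ (Fin n)) : ℝ≥0∞ :=
  ∫⁻ x, ⨆ i, f (x - v i)

/-- The (closed) Voronoi region of the point `p` with respect to the points `v i`. -/
def voronoiRegion {n N : ℕ} (v : Fin N → EuclideanSpace ℝ (Fin n))
    (p : EuclideanSpace ℝ (Fin n)) : Set (EuclideanSpace ℝ (Fin n)) :=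
  {x | ∀ i, dist x p ≤ dist x (v i)}

/-- Nearest-point decoding of a noise with density `f`: the sum, over the distinct points `p` of
the configuration, of the measure with density `f` centered at `p` of the Voronoi region of `p`.
Coinciding points have one common Voronoi region, which is counted once. -/
noncomputable def voronoiP {n N : ℕ} (f : EuclideanSpace ℝ (Fin n) → ℝ≥0∞)
    (v : Fin N → EuclideanSpace ℝ (Fin n)) : ℝ≥0∞ :=
  ∑ p ∈ (Set.finite_range v).toFinset, ∫⁻ x in voronoiRegion v p, f (x - p)

/-- The antipodal configuration `±v₁, ±v₂`. -/
def antipodal {n : ℕ} (w : EuclideanSpace ℝ (Fin n) × EuclideanSpace ℝ (Fin n)) :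
    Fin 4 → EuclideanSpace ℝ (Fin n) :=
  ![w.1, -w.1, w.2, -w.2]

/-- `f(x)` depends only on `|x|`. -/
def IsRadial {n : ℕ} (f : EuclideanSpace ℝ (Fin n) → ℝ≥0∞) : Prop :=
  ∀ x y, ‖x‖ = ‖y‖ → f x = f y

/-- `f(x)` is a nonincreasing function of `|x|` (in particular it is radial). -/
def IsRadiallyNonincreasing {n : ℕ} (f : EuclideanSpace ℝ (Fin n) → ℝ≥0∞) : Prop :=
  ∀ x y, ‖x‖ ≤ ‖y‖ → f y ≤ f x

/-! Let d be the distance to the nearest of ±w₁, ±w₂ and F the radial profile of f. Since ties are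
null, P^Vor_f is the integral of F(d(x)); so is P_f when f is nonincreasing. Two moves then increase
this integral.

Making the pair orthogonal, lengths fixed, enlarges the union of the four discs of radius c, for
every c (`measure_nearDist_le_of_orthogonal`). There is a radial set that the discs cover when the
pair is orthogonal, and outside which the discs about ±u do not meet those about ±v'. By stochastic
dominance this suffices for antitone F.

Making an orthogonal pair equal in length keeps the side L = √E of the rhombus. Each quadrant
consists of parts of the cells of two adjacent vertices. Seen from their own vertices, with the
common side along the first axis, one part and a mirror image of the other are disjoint and fit, up
to a null set, into the square's part and its mirror image (`lintegral_centeredCell_le`). Mirroring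
preserves the norm, so this move needs no monotonicity of F. -/

abbrev Plane := EuclideanSpace ℝ (Fin 2)

theorem Plane.norm_sq (x : Plane) : ‖x‖ ^ 2 = x 0 ^ 2 + x 1 ^ 2 := by
  rw [EuclideanSpace.real_norm_sq_eq, Fin.sum_univ_two]

theorem Plane.inner_eq (x y : Plane) : inner ℝ x y = x 0 * y 0 + x 1 * y 1 := by
  simp [PiLp.inner_apply, Fin.sum_univ_two, mul_comm]

theorem Plane.ae_linear_ne (α β γ : ℝ) (h : α ≠ 0 ∨ β ≠ 0) :
    ∀ᵐ x : Plane, α * x 0 + β * x 1 ≠ γ := by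
  have h0 : (!₂[α, β] : Plane) ≠ 0 := by
    intro h0
    have h1 := congrArg (fun x : Plane => x 0) h0
    have h2 := congrArg (fun x : Plane => x 1) h0
    simp at h1 h2
    tauto
  let φ : Plane →ₗ[ℝ] ℝ := (innerSL ℝ (!₂[α, β] : Plane)).toLinearMap
  have hφ : ∀ x, φ x = α * x 0 + β * x 1 := fun x => by
    simp [φ, Plane.inner_eq]
  have hker : LinearMap.ker φ ≠ ⊤ := by
    intro hk
    have : φ !₂[α, β] = 0 := by
      rw [← LinearMap.mem_ker, hk]; trivial
    rw [hφ] at this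
    simp at this
    rcases h with h | h <;> nlinarith [sq_pos_of_ne_zero h, sq_nonneg α, sq_nonneg β]
  rw [ae_iff]
  by_cases hx : ∃ x₀ : Plane, α * x₀ 0 + β * x₀ 1 = γ
  · obtain ⟨x₀, hx₀⟩ := hx
    have : {x : Plane | ¬ (α * x 0 + β * x 1 ≠ γ)} =
        (fun x => x + (-x₀)) ⁻¹' (LinearMap.ker φ : Set Plane) := by
      ext x
      simp only [Set.mem_ofPred_eq, not_not, Set.mem_preimage, SetLike.mem_coe,
        LinearMap.mem_ker, hφ, PiLp.add_apply, PiLp.neg_apply]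
      constructor <;> intro h <;> linarith
    rw [this, measure_preimage_add_right]
    exact Measure.addHaar_submodule _ _ hker
  · have : {x : Plane | ¬ (α * x 0 + β * x 1 ≠ γ)} = ∅ := by
      ext x
      simpa using fun h => hx ⟨x, h⟩
    rw [this]; simp

/-- The reflection of the plane with matrix `[c, s; s, -c]`. -/
noncomputable def Plane.refl (c s : ℝ) (h : c ^ 2 + s ^ 2 = 1) : Plane ≃ₗᵢ[ℝ] Plane :=
  LinearIsometry.toLinearIsometryEquiv
    { toFun := fun x => !₂[c * x 0 + s * x 1, s * x 0 - c * x 1]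
      map_add' := fun x y => by ext i; fin_cases i <;> simp <;> ring
      map_smul' := fun r x => by ext i; fin_cases i <;> simp <;> ring
      norm_map' := fun x => by
        rw [← sq_eq_sq₀ (norm_nonneg _) (norm_nonneg _), Plane.norm_sq, Plane.norm_sq]
        simp
        linear_combination (x 0 ^ 2 + x 1 ^ 2) * h } rfl

theorem Plane.refl_apply (c s : ℝ) (h : c ^ 2 + s ^ 2 = 1) (x : Plane) :
    Plane.refl c s h x = !₂[c * x 0 + s * x 1, s * x 0 - c * x 1] := by
  simp [Plane.refl]

theorem Plane.lintegral_comp_isometry (T : Plane ≃ₗᵢ[ℝ] Plane) (g : Plane → ℝ≥0∞) :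
    ∫⁻ x, g (T x) = ∫⁻ x, g x :=
  T.measurePreserving.lintegral_comp_emb T.toHomeomorph.measurableEmbedding g

/-! ### Reduction to the distance to the nearest point -/

/-- The distance from `x` to the nearest of the points `±w₁, ±w₂`. -/
noncomputable def nearDist (w : Plane × Plane) (x : Plane) : ℝ :=
  min (min ‖x - w.1‖ ‖x + w.1‖) (min ‖x - w.2‖ ‖x + w.2‖)

theorem continuous_nearDist (w : Plane × Plane) : Continuous (nearDist w) := by
  unfold nearDist; fun_prop

theorem nearDist_comp_isometry (T : Plane ≃ₗᵢ[ℝ] Plane) (w : Plane × Plane) (x : Plane) :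
    nearDist (T w.1, T w.2) (T x) = nearDist w x := by
  simp only [nearDist, ← map_sub, ← map_add, T.norm_map]

theorem nearDist_le_dist (w : Plane × Plane) (x : Plane) (i : Fin 4) :
    nearDist w x ≤ dist x (antipodal w i) := by
  fin_cases i <;> simp [nearDist, antipodal, dist_eq_norm]

theorem exists_nearDist_eq_dist (w : Plane × Plane) (x : Plane) :
    ∃ i, nearDist w x = dist x (antipodal w i) := by
  have h : nearDist w x = ‖x - w.1‖ ∨ nearDist w x = ‖x + w.1‖ ∨
      nearDist w x = ‖x - w.2‖ ∨ nearDist w x = ‖x + w.2‖ := by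
    unfold nearDist
    grind
  rcases h with h | h | h | h
  · exact ⟨0, by simp [antipodal, dist_eq_norm, h]⟩
  · exact ⟨1, by simp [antipodal, dist_eq_norm, h]⟩
  · exact ⟨2, by simp [antipodal, dist_eq_norm, h]⟩
  · exact ⟨3, by simp [antipodal, dist_eq_norm, h]⟩

/-- The radial profile of a density. -/
noncomputable def radialProfile (f : Plane → ℝ≥0∞) (r : ℝ) : ℝ≥0∞ := f !₂[max r 0, 0]

theorem norm_axis_vector (r : ℝ) (hr : 0 ≤ r) : ‖(!₂[r, 0] : Plane)‖ = r := by
  rw [← sq_eq_sq₀ (norm_nonneg _) hr, Plane.norm_sq]; simp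

theorem radialProfile_norm {f : Plane → ℝ≥0∞} (hf : IsRadial f) (x : Plane) :
    radialProfile f ‖x‖ = f x := by
  apply hf
  rw [norm_axis_vector _ (le_max_right _ _), max_eq_left (norm_nonneg _)]

theorem measurable_radialProfile {f : Plane → ℝ≥0∞} (hf : Measurable f) :
    Measurable (radialProfile f) := by
  refine hf.comp (Continuous.measurable ?_)
  refine (PiLp.continuous_toLp 2 (fun _ : Fin 2 => ℝ)).comp (continuous_pi fun i => ?_)
  fin_cases i <;> simp <;> fun_prop

theorem antitone_radialProfile {f : Plane → ℝ≥0∞} (hf : IsRadiallyNonincreasing f) :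
    Antitone (radialProfile f) := by
  intro r s h
  apply hf
  rw [norm_axis_vector _ (le_max_right _ _), norm_axis_vector _ (le_max_right _ _)]
  exact max_le_max_right _ h

theorem IsRadiallyNonincreasing.isRadial {f : Plane → ℝ≥0∞} (hf : IsRadiallyNonincreasing f) :
    IsRadial f :=
  fun _ _ h => le_antisymm (hf _ _ h.ge) (hf _ _ h.le)

theorem densityP_antipodal {f : Plane → ℝ≥0∞} (hf : IsRadiallyNonincreasing f)
    (w : Plane × Plane) :
    densityP f (antipodal w) = ∫⁻ x, radialProfile f (nearDist w x) := by
  refine lintegral_congr fun x => ?_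
  obtain ⟨i, hi⟩ := exists_nearDist_eq_dist w x
  refine le_antisymm (iSup_le fun j => ?_) ?_
  · rw [← radialProfile_norm hf.isRadial, ← dist_eq_norm]
    exact antitone_radialProfile hf (nearDist_le_dist w x j)
  · refine le_iSup_of_le i ?_
    rw [← radialProfile_norm hf.isRadial, ← dist_eq_norm, hi]

theorem ae_dist_ne {p q : Plane} (h : p ≠ q) : ∀ᵐ x : Plane, dist x p ≠ dist x q := by
  have h' : q 0 - p 0 ≠ 0 ∨ q 1 - p 1 ≠ 0 := by
    by_contra! hc
    apply h
    ext i
    fin_cases i <;> simp <;> linarith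
  filter_upwards [Plane.ae_linear_ne _ _ ((‖q‖ ^ 2 - ‖p‖ ^ 2) / 2) h'] with x hx hd
  apply hx
  rw [dist_eq_norm, dist_eq_norm, ← sq_eq_sq₀ (norm_nonneg _) (norm_nonneg _)] at hd
  simp only [Plane.norm_sq, PiLp.sub_apply] at hd ⊢
  linarith

theorem measurableSet_voronoiRegion {n N : ℕ} (v : Fin N → EuclideanSpace ℝ (Fin n))
    (p : EuclideanSpace ℝ (Fin n)) : MeasurableSet (voronoiRegion v p) := by
  have : voronoiRegion v p = ⋂ i, {x | dist x p ≤ dist x (v i)} := by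
    ext x; simp [voronoiRegion]
  rw [this]
  exact MeasurableSet.iInter fun i =>
    (isClosed_le (by fun_prop) (by fun_prop)).measurableSet

/-- Almost every x is equidistant from no two distinct points, so exactly one summand survives, that
of the nearest point. Monotonicity plays no role, because the region and not the size of f selects
the point. -/
theorem voronoiP_antipodal {f : Plane → ℝ≥0∞} (hm : Measurable f) (hf : IsRadial f)
    (w : Plane × Plane) :
    voronoiP f (antipodal w) = ∫⁻ x, radialProfile f (nearDist w x) := by
  classical
  unfold voronoiP
  set s := (Set.finite_range (antipodal w)).toFinset with hs
  have h1 : ∀ p, ∫⁻ x in voronoiRegion (antipodal w) p, f (x - p) =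
      ∫⁻ x, (voronoiRegion (antipodal w) p).indicator (fun x => f (x - p)) x := fun p =>
    (lintegral_indicator (measurableSet_voronoiRegion _ _) _).symm
  simp_rw [h1]
  have h3 : ∀ p, Measurable
      ((voronoiRegion (antipodal w) p).indicator (fun x => f (x - p))) := fun p =>
    (hm.comp (measurable_id.sub_const p)).indicator (measurableSet_voronoiRegion _ _)
  rw [← lintegral_finsetSum _ fun p _ => h3 p]
  have h2 : ∀ᵐ x : Plane, ∀ i j, antipodal w i ≠ antipodal w j →
      dist x (antipodal w i) ≠ dist x (antipodal w j) := by
    refine ae_all_iff.2 fun i => ae_all_iff.2 fun j => ?_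
    by_cases h : antipodal w i = antipodal w j
    · simp [h]
    · filter_upwards [ae_dist_ne h] with x hx _ using hx
  refine lintegral_congr_ae ?_
  filter_upwards [h2] with x hx
  obtain ⟨i, hi⟩ := exists_nearDist_eq_dist w x
  rw [Finset.sum_eq_single (antipodal w i)]
  · rw [Set.indicator_of_mem, ← radialProfile_norm hf, ← dist_eq_norm, hi]
    intro j
    rw [← hi]
    exact nearDist_le_dist w x j
  · intro p hp hpi
    obtain ⟨j, rfl⟩ : ∃ j, antipodal w j = p := by simpa [hs] using hp
    apply Set.indicator_of_notMem
    intro hmem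
    refine hx j i hpi (le_antisymm (hmem i) ?_)
    rw [← hi]
    exact nearDist_le_dist w x j
  · intro h
    exact absurd (by simp [hs]) h

/-! ### Layer cake and stochastic dominance -/

/-- Tonelli, after writing each value c, possibly ∞, as the length of {t > 0 : t < c}. -/
theorem lintegral_eq_lintegral_meas_ofReal_lt {α : Type*} [MeasurableSpace α] (μ : Measure α)
    [SFinite μ] {g : α → ℝ≥0∞} (hg : Measurable g) :
    ∫⁻ x, g x ∂μ = ∫⁻ t in Set.Ioi (0 : ℝ), μ {x | ENNReal.ofReal t < g x} := by
  have hS : MeasurableSet {p : α × ℝ | ENNReal.ofReal p.2 < g p.1} :=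
    measurableSet_lt (ENNReal.measurable_ofReal.comp measurable_snd) (hg.comp measurable_fst)
  have h1 : ∀ c : ℝ≥0∞,
      c = (volume.restrict (Set.Ioi (0 : ℝ))) {t | ENNReal.ofReal t < c} := by
    intro c
    rw [Measure.restrict_apply
      (measurableSet_lt ENNReal.measurable_ofReal measurable_const)]
    by_cases hc : c = ∞
    · have : {t : ℝ | ENNReal.ofReal t < c} ∩ Set.Ioi 0 = Set.Ioi 0 := by
        ext t; simp [hc]
      rw [this, Real.volume_Ioi, hc]
    · have : {t : ℝ | ENNReal.ofReal t < c} ∩ Set.Ioi 0 = Set.Ioo 0 c.toReal := by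
        ext t
        simp only [Set.mem_inter_iff, Set.mem_ofPred_eq, Set.mem_Ioi, Set.mem_Ioo]
        rw [and_comm]
        refine and_congr_right fun ht => ?_
        rw [ENNReal.ofReal_lt_iff_lt_toReal ht.le hc]
      rw [this, Real.volume_Ioo, sub_zero, ENNReal.ofReal_toReal hc]
  calc ∫⁻ x, g x ∂μ
      = ∫⁻ x, (volume.restrict (Set.Ioi (0 : ℝ))) {t | ENNReal.ofReal t < g x} ∂μ :=
        lintegral_congr fun x => h1 (g x)
    _ = (μ.prod (volume.restrict (Set.Ioi (0 : ℝ)))) {p | ENNReal.ofReal p.2 < g p.1} :=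
        (Measure.prod_apply hS).symm
    _ = _ := Measure.prod_apply_symm hS

/-- Stochastic dominance: an antitone function has the larger integral along the function with
the larger sublevel sets. -/
theorem lintegral_antitone_comp_le {α : Type*} [MeasurableSpace α] {μ : Measure α} [SFinite μ]
    {F : ℝ → ℝ≥0∞} (hF : Antitone F) {m m' : α → ℝ} (hm : Measurable m) (hm' : Measurable m')
    (h : ∀ c, μ {x | m x ≤ c} ≤ μ {x | m' x ≤ c}) :
    ∫⁻ x, F (m x) ∂μ ≤ ∫⁻ x, F (m' x) ∂μ := by
  rw [lintegral_eq_lintegral_meas_ofReal_lt μ (g := fun x => F (m x)) (hF.measurable.comp hm),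
    lintegral_eq_lintegral_meas_ofReal_lt μ (g := fun x => F (m' x)) (hF.measurable.comp hm')]
  refine lintegral_mono fun t => ?_
  set I : Set ℝ := {r | ENNReal.ofReal t < F r} with hI
  have hlow : ∀ r s, r ≤ s → s ∈ I → r ∈ I := fun r s hrs hs => lt_of_lt_of_le hs (hF hrs)
  change μ (m ⁻¹' I) ≤ μ (m' ⁻¹' I)
  by_cases hmax : ∃ c ∈ I, ∀ r ∈ I, r ≤ c
  · obtain ⟨c, hc, hmax⟩ := hmax
    have hIc : I = Set.Iic c := Set.ext fun r => ⟨hmax r, fun hr => hlow r c hr hc⟩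
    rw [hIc]
    exact h c
  -- Without a largest element the lower set `I` is a countable directed union of closed rays with
  -- rational endpoints, so continuity from below applies.
  · push Not at hmax
    have hIu : I = ⋃ q : {q : ℚ // (q : ℝ) ∈ I}, Set.Iic ((q : ℚ) : ℝ) := by
      ext r
      simp only [Set.mem_iUnion, Set.mem_Iic]
      refine ⟨fun hr => ?_, fun ⟨q, hq⟩ => hlow _ _ hq q.2⟩
      obtain ⟨s, hs, hrs⟩ := hmax r hr
      obtain ⟨q, hrq, hqs⟩ := exists_rat_btwn hrs
      exact ⟨⟨q, hlow _ _ hqs.le hs⟩, hrq.le⟩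
    have hdir : ∀ k : α → ℝ, Directed (· ⊆ ·)
        fun q : {q : ℚ // (q : ℝ) ∈ I} => k ⁻¹' Set.Iic ((q : ℚ) : ℝ) := fun k => by
      refine Monotone.directed_le fun p q hpq => Set.preimage_mono (Set.Iic_subset_Iic.2 ?_)
      exact_mod_cast hpq
    rw [hIu, Set.preimage_iUnion, Set.preimage_iUnion, (hdir m).measure_iUnion,
      (hdir m').measure_iUnion]
    exact iSup_mono fun q => h q

/-! ### Making the pair orthogonal -/

theorem min_norm_le_iff (w x : Plane) {c : ℝ} (hc : 0 ≤ c) :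
    min ‖x - w‖ ‖x + w‖ ≤ c ↔ ‖x‖ ^ 2 + ‖w‖ ^ 2 - c ^ 2 ≤ 2 * |inner ℝ x w| := by
  rw [min_le_iff, ← sq_le_sq₀ (norm_nonneg _) hc, ← sq_le_sq₀ (norm_nonneg _) hc,
    norm_sub_sq_real, norm_add_sq_real]
  rcases abs_cases (inner ℝ x w) with ⟨h, h'⟩ | ⟨h, h'⟩ <;> rw [h] <;> constructor
  · rintro (h | h) <;> linarith
  · intro h; left; linarith
  · rintro (h | h) <;> linarith
  · intro h; right; linarith

/-- Parseval for the orthogonal basis u, v with denominators cleared. -/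
theorem inner_sq_add_inner_sq {u v : Plane} (h : inner ℝ u v = 0) (x : Plane) :
    ‖v‖ ^ 2 * inner ℝ x u ^ 2 + ‖u‖ ^ 2 * inner ℝ x v ^ 2 =
      ‖u‖ ^ 2 * ‖v‖ ^ 2 * ‖x‖ ^ 2 := by
  simp only [Plane.norm_sq, Plane.inner_eq] at h ⊢
  linear_combination ((x 0 ^ 2 - x 1 ^ 2) * (u 0 * v 0 - u 1 * v 1) +
    2 * x 0 * x 1 * (u 0 * v 1 + u 1 * v 0)) * h

/-- Inside `S` the orthogonal discs cover everything. Outside `S` their two pairs are disjoint, so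
the measure is the sum of the two, an upper bound for any v of the same length by subadditivity and
symmetry. -/
theorem measure_nearDist_le_of_orthogonal {u v v' : Plane} (h : inner ℝ u v' = 0)
    (hv : ‖v'‖ = ‖v‖) (hu0 : u ≠ 0) (hv0 : v ≠ 0) (c : ℝ) :
    volume {x | nearDist (u, v) x ≤ c} ≤ volume {x | nearDist (u, v') x ≤ c} := by
  rcases lt_or_ge c 0 with hc | hc
  · have : {x | nearDist (u, v) x ≤ c} = ∅ := by
      ext x
      simp only [Set.mem_ofPred_eq, Set.mem_empty_iff_false, iff_false, not_le]
      exact hc.trans_le (by unfold nearDist; positivity)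
    rw [this]; simp
  set A : Plane → Set Plane := fun w => {x | min ‖x - w‖ ‖x + w‖ ≤ c} with hA
  have hAm : ∀ w, MeasurableSet (A w) := fun w =>
    (isClosed_le (by fun_prop) (by fun_prop)).measurableSet
  have hU : ∀ w, {x | nearDist (u, w) x ≤ c} = A u ∪ A w := fun w => by
    ext x; simp only [nearDist, hA, Set.mem_ofPred_eq, Set.mem_union]; exact min_le_iff
  -- The threshold for |⟨x, w⟩| above which x lies in `A w`. Truncation at 0 permits comparing
  -- squares.
  set P : Plane → ℝ → ℝ := fun x a => max ((‖x‖ ^ 2 + a ^ 2 - c ^ 2) / 2) 0 with hP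
  -- Parseval with both inner products replaced by their thresholds. Only norms enter, so `S` is
  -- invariant under isometries.
  set S : Set Plane := {x | ‖v‖ ^ 2 * P x ‖u‖ ^ 2 + ‖u‖ ^ 2 * P x ‖v‖ ^ 2 ≤
    ‖u‖ ^ 2 * ‖v‖ ^ 2 * ‖x‖ ^ 2} with hS
  have hSm : MeasurableSet S := (isClosed_le (by fun_prop) (by fun_prop)).measurableSet
  have hmem : ∀ w x, x ∈ A w ↔ P x ‖w‖ ≤ |inner ℝ x w| := fun w x => by
    simp only [hA, hP, Set.mem_ofPred_eq, min_norm_le_iff w x hc]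
    rw [max_le_iff, and_iff_left (abs_nonneg _), div_le_iff₀ two_pos, mul_comm]
  have hu2 : 0 < ‖u‖ ^ 2 := by positivity
  have hv2 : 0 < ‖v‖ ^ 2 := by positivity
  have hP0 : ∀ x a, 0 ≤ P x a := fun x a => le_max_right _ _
  have hcover : S ⊆ A u ∪ A v' := by
    intro x hx
    by_contra hn
    rw [Set.mem_union, hmem, hmem, hv] at hn
    push Not at hn
    have e := inner_sq_add_inner_sq h x
    rw [hv] at e
    have h1 : inner ℝ x u ^ 2 < P x ‖u‖ ^ 2 :=
      sq_lt_sq.2 (by rw [abs_of_nonneg (hP0 _ _)]; exact hn.1)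
    have h2 : inner ℝ x v' ^ 2 < P x ‖v‖ ^ 2 :=
      sq_lt_sq.2 (by rw [abs_of_nonneg (hP0 _ _)]; exact hn.2)
    rw [hS, Set.mem_ofPred_eq] at hx
    nlinarith [mul_lt_mul_of_pos_left h1 hv2, mul_lt_mul_of_pos_left h2 hu2]
  have hdisj : Disjoint (A u \ S) (A v' \ S) := by
    rw [Set.disjoint_left]
    rintro x ⟨h1, hxS⟩ ⟨h2, -⟩
    rw [hmem] at h1 h2
    rw [hv] at h2
    apply hxS
    have e := inner_sq_add_inner_sq h x
    rw [hv] at e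
    have h3 : P x ‖u‖ ^ 2 ≤ inner ℝ x u ^ 2 := sq_le_sq.2 (by rwa [abs_of_nonneg (hP0 _ _)])
    have h4 : P x ‖v‖ ^ 2 ≤ inner ℝ x v' ^ 2 := sq_le_sq.2 (by rwa [abs_of_nonneg (hP0 _ _)])
    rw [hS, Set.mem_ofPred_eq]
    nlinarith [mul_le_mul_of_nonneg_left h3 hv2.le, mul_le_mul_of_nonneg_left h4 hu2.le]
  have hrot : volume (A v \ S) = volume (A v' \ S) := by
    set T : Plane ≃ₗᵢ[ℝ] Plane := (ℝ ∙ (v - v'))ᗮ.reflection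
    have hT : T v = v' := Submodule.reflection_sub hv.symm
    have : A v \ S = T ⁻¹' (A v' \ S) := by
      ext x
      simp only [hA, hS, hP, Set.mem_sdiff, Set.mem_preimage, Set.mem_ofPred_eq, ← hT,
        ← map_sub, ← map_add, T.norm_map]
    rw [this, T.measurePreserving.measure_preimage ((hAm _).diff hSm).nullMeasurableSet]
  rw [hU, hU, ← measure_inter_add_sdiff (A u ∪ A v) hSm, ← measure_inter_add_sdiff (A u ∪ A v') hSm,
    Set.inter_eq_right.2 hcover, Set.union_sdiff_distrib, Set.union_sdiff_distrib,
    measure_union hdisj ((hAm _).diff hSm), ← hrot]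
  exact add_le_add (measure_mono Set.inter_subset_right) (measure_union_le _ _)

theorem exists_orthogonal_norm_eq (u v : Plane) : ∃ v' : Plane, inner ℝ u v' = 0 ∧ ‖v'‖ = ‖v‖ ∧
    ∀ F : ℝ → ℝ≥0∞, Antitone F →
      ∫⁻ x, F (nearDist (u, v) x) ≤ ∫⁻ x, F (nearDist (u, v') x) := by
  by_cases hu0 : u = 0
  · exact ⟨v, by simp [hu0], rfl, fun _ _ => le_rfl⟩
  by_cases hv0 : v = 0
  · exact ⟨v, by simp [hv0], rfl, fun _ _ => le_rfl⟩
  set J : Plane := !₂[-u 1, u 0] with hJ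
  have hJn : ‖J‖ = ‖u‖ := by
    rw [← sq_eq_sq₀ (norm_nonneg _) (norm_nonneg _), Plane.norm_sq, Plane.norm_sq]
    simp [hJ]; ring
  have h1 : inner ℝ u ((‖v‖ / ‖u‖) • J) = 0 := by
    rw [inner_smul_right, Plane.inner_eq]; simp [hJ]; right; ring
  have h2 : ‖(‖v‖ / ‖u‖) • J‖ = ‖v‖ := by
    rw [norm_smul, hJn, Real.norm_of_nonneg (by positivity),
      div_mul_cancel₀ _ (norm_ne_zero_iff.2 hu0)]
  exact ⟨_, h1, h2, fun F hF => lintegral_antitone_comp_le hF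
    (continuous_nearDist _).measurable (continuous_nearDist _).measurable
    (measure_nearDist_le_of_orthogonal h1 h2 hu0 hv0)⟩

/-! ### Folding the rhombus and recentering its cells -/

/-- Folding along a symmetry `T` of `g` with fundamental domain `D`. -/
theorem lintegral_eq_two_mul_of_symm {g : Plane → ℝ≥0∞} (hg : Measurable g)
    (T : Plane ≃ₗᵢ[ℝ] Plane) (hT : ∀ x, g (T x) = g x) {D : Set Plane} (hD : MeasurableSet D)
    (h : ∀ᵐ x, (x ∈ D ∧ T x ∉ D) ∨ (x ∉ D ∧ T x ∈ D)) :
    ∫⁻ x, g x = 2 * ∫⁻ x, D.indicator g x := by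
  have h1 : ∫⁻ x, g x = ∫⁻ x, (D.indicator g x + D.indicator g (T x)) := by
    refine lintegral_congr_ae ?_
    filter_upwards [h] with x hx
    rcases hx with ⟨h1, h2⟩ | ⟨h1, h2⟩ <;> simp [h1, h2, hT]
  rw [h1, lintegral_add_left (hg.indicator hD), Plane.lintegral_comp_isometry, two_mul]

/-- The rhombus with half-diagonals `a` and `b` along the axes. -/
noncomputable def rhombus (a b : ℝ) : Plane × Plane := (!₂[a, 0], !₂[0, b])

/-- The part of the open first quadrant that is nearer to `(a, 0)` than to `(0, b)`. -/
def quadrantCell (a b : ℝ) : Set Plane :=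
  {x | 0 < x 0 ∧ 0 < x 1 ∧ ‖x - !₂[a, 0]‖ < ‖x - !₂[0, b]‖}

/-- The set `quadrantCell a b` seen from `(a, 0)`, in coordinates whose first axis points
to `(0, b)`. -/
def centeredCell (a b L : ℝ) : Set Plane :=
  {z | 0 < b * z 0 + a * z 1 ∧ 2 * z 0 < L ∧ a * z 0 - b * z 1 < a * L}

theorem measurableSet_quadrantCell (a b : ℝ) : MeasurableSet (quadrantCell a b) := by
  have h : IsOpen ({x : Plane | 0 < x 0} ∩ ({x | 0 < x 1} ∩
      {x | ‖x - !₂[a, 0]‖ < ‖x - !₂[0, b]‖})) :=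
    (isOpen_lt (by fun_prop) (by fun_prop)).inter
      ((isOpen_lt (by fun_prop) (by fun_prop)).inter (isOpen_lt (by fun_prop) (by fun_prop)))
  exact h.measurableSet

theorem measurableSet_centeredCell (a b L : ℝ) : MeasurableSet (centeredCell a b L) := by
  have h : IsOpen ({z : Plane | 0 < b * z 0 + a * z 1} ∩ ({z | 2 * z 0 < L} ∩
      {z | a * z 0 - b * z 1 < a * L})) :=
    (isOpen_lt (by fun_prop) (by fun_prop)).inter
      ((isOpen_lt (by fun_prop) (by fun_prop)).inter (isOpen_lt (by fun_prop) (by fun_prop)))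
  exact h.measurableSet

theorem norm_lt_norm_iff_sq (x y : Plane) :
    ‖x‖ < ‖y‖ ↔ x 0 ^ 2 + x 1 ^ 2 < y 0 ^ 2 + y 1 ^ 2 := by
  rw [← sq_lt_sq₀ (norm_nonneg _) (norm_nonneg _), Plane.norm_sq, Plane.norm_sq]

theorem norm_le_norm_iff_sq (x y : Plane) :
    ‖x‖ ≤ ‖y‖ ↔ x 0 ^ 2 + x 1 ^ 2 ≤ y 0 ^ 2 + y 1 ^ 2 := by
  rw [← sq_le_sq₀ (norm_nonneg _) (norm_nonneg _), Plane.norm_sq, Plane.norm_sq]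

theorem norm_eq_norm_iff_sq (x y : Plane) :
    ‖x‖ = ‖y‖ ↔ x 0 ^ 2 + x 1 ^ 2 = y 0 ^ 2 + y 1 ^ 2 := by
  rw [← sq_eq_sq₀ (norm_nonneg _) (norm_nonneg _), Plane.norm_sq, Plane.norm_sq]

theorem nearDist_neg_fst (u v x : Plane) : nearDist (-u, v) x = nearDist (u, v) x := by
  simp only [nearDist, sub_neg_eq_add, ← sub_eq_add_neg, min_comm]

theorem nearDist_neg_snd (u v x : Plane) : nearDist (u, -v) x = nearDist (u, v) x := by
  simp only [nearDist, sub_neg_eq_add, ← sub_eq_add_neg, min_comm ‖x + v‖]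

/-- The reflection `(x₀, x₁) ↦ (-x₀, x₁)`. -/
noncomputable def reflFst : Plane ≃ₗᵢ[ℝ] Plane := Plane.refl (-1) 0 (by norm_num)

/-- The reflection `(x₀, x₁) ↦ (x₀, -x₁)`. -/
noncomputable def reflSnd : Plane ≃ₗᵢ[ℝ] Plane := Plane.refl 1 0 (by norm_num)

theorem nearDist_rhombus_reflFst (a b : ℝ) (x : Plane) :
    nearDist (rhombus a b) (reflFst x) = nearDist (rhombus a b) x := by
  have h : (-(reflFst (rhombus a b).1), reflFst (rhombus a b).2) = rhombus a b := by
    ext i <;> fin_cases i <;> simp [reflFst, Plane.refl_apply, rhombus]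
  conv_lhs => rw [← h]
  rw [nearDist_neg_fst, nearDist_comp_isometry]

theorem nearDist_rhombus_reflSnd (a b : ℝ) (x : Plane) :
    nearDist (rhombus a b) (reflSnd x) = nearDist (rhombus a b) x := by
  have h : (reflSnd (rhombus a b).1, -(reflSnd (rhombus a b).2)) = rhombus a b := by
    ext i <;> fin_cases i <;> simp [reflSnd, Plane.refl_apply, rhombus]
  conv_lhs => rw [← h]
  rw [nearDist_neg_snd, nearDist_comp_isometry]

theorem nearDist_rhombus_of_nonneg {a b : ℝ} (ha : 0 ≤ a) (hb : 0 ≤ b) {x : Plane}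
    (h0 : 0 ≤ x 0) (h1 : 0 ≤ x 1) :
    nearDist (rhombus a b) x = min ‖x - !₂[a, 0]‖ ‖x - !₂[0, b]‖ := by
  unfold nearDist rhombus
  congr 1
  · apply min_eq_left
    rw [norm_le_norm_iff_sq]
    simp
    nlinarith [mul_nonneg ha h0]
  · apply min_eq_left
    rw [norm_le_norm_iff_sq]
    simp
    nlinarith [mul_nonneg hb h1]

theorem lintegral_quadrantCell_eq_centeredCell {a b L : ℝ} (hL : 0 < L) (h : L ^ 2 = a ^ 2 + b ^ 2)
    (F : ℝ → ℝ≥0∞) :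
    ∫⁻ x, (quadrantCell a b).indicator (fun x => F ‖x - !₂[a, 0]‖) x =
      ∫⁻ z, (centeredCell a b L).indicator (fun z => F ‖z‖) z := by
  -- (-a/L, b/L) is the unit vector from (a, 0) to (0, b), the image of the first axis under the
  -- reflection.
  have hcs : (-a / L) ^ 2 + (b / L) ^ 2 = 1 := by
    field_simp; linarith
  rw [← lintegral_add_left_eq_self _ (!₂[a, 0] : Plane),
    ← Plane.lintegral_comp_isometry (Plane.refl (-a / L) (b / L) hcs)]
  refine lintegral_congr fun z => ?_
  have hmem : !₂[a, 0] + Plane.refl (-a / L) (b / L) hcs z ∈ quadrantCell a b ↔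
      z ∈ centeredCell a b L := by
    have e0 : a + (-a / L * z 0 + b / L * z 1) = (a * L - (a * z 0 - b * z 1)) / L := by
      field_simp; ring
    have e1 : b / L * z 0 - -a / L * z 1 = (b * z 0 + a * z 1) / L := by
      field_simp; ring
    simp only [quadrantCell, centeredCell, Set.mem_ofPred_eq, norm_lt_norm_iff_sq,
      Plane.refl_apply]
    simp only [PiLp.add_apply, PiLp.sub_apply, Matrix.cons_val_zero, Matrix.cons_val_one,
      zero_add, e0, e1, sub_zero]
    rw [div_pos_iff_of_pos_right hL, div_pos_iff_of_pos_right hL, sub_pos]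
    have e2 : ((a * L - (a * z 0 - b * z 1)) / L) ^ 2 + ((b * z 0 + a * z 1) / L - b) ^ 2 =
        ((a * L - (a * z 0 - b * z 1)) / L - a) ^ 2 + ((b * z 0 + a * z 1) / L) ^ 2
          + L * (L - 2 * z 0) := by
      field_simp
      linear_combination (2 * L * z 0 - L ^ 2) * h
    rw [e2, lt_add_iff_pos_right, mul_pos_iff_of_pos_left hL, sub_pos]
    tauto
  by_cases hz : z ∈ centeredCell a b L
  · rw [Set.indicator_of_mem hz, Set.indicator_of_mem (hmem.2 hz), add_sub_cancel_left,
      LinearIsometryEquiv.norm_map]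
  · rw [Set.indicator_of_notMem hz, Set.indicator_of_notMem (mt hmem.1 hz)]

theorem lintegral_rhombus {a b L : ℝ} (ha : 0 ≤ a) (hb : 0 ≤ b) (hL : 0 < L)
    (h : L ^ 2 = a ^ 2 + b ^ 2) {F : ℝ → ℝ≥0∞} (hF : Measurable F) :
    ∫⁻ x, F (nearDist (rhombus a b) x) =
      4 * ((∫⁻ z, (centeredCell a b L).indicator (fun z => F ‖z‖) z) +
        (∫⁻ z, (centeredCell b a L).indicator (fun z => F ‖z‖) z)) := by
  have hD0 : MeasurableSet {x : Plane | 0 < x 0} :=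
    (isOpen_lt (by fun_prop) (by fun_prop)).measurableSet
  have hD1 : MeasurableSet {x : Plane | 0 < x 1} :=
    (isOpen_lt (by fun_prop) (by fun_prop)).measurableSet
  have hm : Measurable fun x => F (nearDist (rhombus a b) x) :=
    hF.comp (continuous_nearDist _).measurable
  have hm1 : Measurable ((quadrantCell a b).indicator fun x => F ‖x - !₂[a, 0]‖) :=
    (hF.comp (Continuous.measurable (by fun_prop))).indicator (measurableSet_quadrantCell _ _)
  have hfold : ∫⁻ x, F (nearDist (rhombus a b) x) =
      2 * (2 * ∫⁻ x, {x : Plane | 0 < x 1}.indicator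
        ({x : Plane | 0 < x 0}.indicator fun x => F (nearDist (rhombus a b) x)) x) := by
    rw [lintegral_eq_two_mul_of_symm hm reflFst
      (fun x => by rw [nearDist_rhombus_reflFst]) hD0 ?_, lintegral_eq_two_mul_of_symm
      (hm.indicator hD0) reflSnd ?_ hD1 ?_]
    · intro x
      have : reflSnd x 0 = x 0 := by simp [reflSnd, Plane.refl_apply]
      simp only [Set.indicator, Set.mem_ofPred_eq, this, nearDist_rhombus_reflSnd]
    · filter_upwards [Plane.ae_linear_ne 0 1 0 (by simp)] with x hx
      have : reflSnd x 1 = -x 1 := by simp [reflSnd, Plane.refl_apply]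
      simp only [this]
      have : x 1 ≠ 0 := by simpa using hx
      grind
    · filter_upwards [Plane.ae_linear_ne 1 0 0 (by simp)] with x hx
      have : reflFst x 0 = -x 0 := by simp [reflFst, Plane.refl_apply]
      simp only [this]
      have : x 0 ≠ 0 := by simpa using hx
      grind
  -- The reflection in the diagonal turns the part nearer to (0, b) into a quadrant cell with a and
  -- b exchanged.
  have hswap : ∫⁻ x, (quadrantCell b a).indicator (fun x => F ‖x - !₂[b, 0]‖) x =
      ∫⁻ x, {x : Plane | 0 < x 0 ∧ 0 < x 1 ∧ ‖x - !₂[0, b]‖ < ‖x - !₂[a, 0]‖}.indicator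
        (fun x => F ‖x - !₂[0, b]‖) x := by
    have hs : (0 : ℝ) ^ 2 + 1 ^ 2 = 1 := by norm_num
    rw [← Plane.lintegral_comp_isometry (Plane.refl 0 1 hs)]
    refine lintegral_congr fun x => ?_
    have e1 : ‖Plane.refl 0 1 hs x - !₂[b, 0]‖ = ‖x - !₂[0, b]‖ := by
      rw [norm_eq_norm_iff_sq]; simp [Plane.refl_apply]; ring
    have e2 : ‖Plane.refl 0 1 hs x - !₂[0, a]‖ = ‖x - !₂[a, 0]‖ := by
      rw [norm_eq_norm_iff_sq]; simp [Plane.refl_apply]; ring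
    have e3 : Plane.refl 0 1 hs x 0 = x 1 := by simp [Plane.refl_apply]
    have e4 : Plane.refl 0 1 hs x 1 = x 0 := by simp [Plane.refl_apply]
    simp only [Set.indicator, quadrantCell, Set.mem_ofPred_eq, e1, e2, e3, e4]
    grind
  rw [hfold, ← mul_assoc, ← lintegral_quadrantCell_eq_centeredCell hL h,
    ← lintegral_quadrantCell_eq_centeredCell hL (by linarith : L ^ 2 = b ^ 2 + a ^ 2),
    hswap, ← lintegral_add_left hm1]
  congr 1
  · norm_num
  refine lintegral_congr_ae ?_
  have hne : (!₂[a, 0] : Plane) ≠ !₂[0, b] := by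
    intro he
    have h0 := congrArg (fun x : Plane => x 0) he
    have h1 := congrArg (fun x : Plane => x 1) he
    simp at h0 h1
    subst h0
    subst h1
    nlinarith
  filter_upwards [ae_dist_ne hne] with x hx
  rw [dist_eq_norm, dist_eq_norm] at hx
  simp only [Set.indicator, quadrantCell, Set.mem_ofPred_eq]
  by_cases h0 : 0 < x 0
  · by_cases h1 : 0 < x 1
    · simp only [h0, h1, true_and, if_true, nearDist_rhombus_of_nonneg ha hb h0.le h1.le]
      rcases lt_or_gt_of_ne hx with hlt | hlt
      · simp [hlt, hlt.le, hlt.not_gt]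
      · simp [hlt, hlt.le, hlt.not_gt]
    · simp [h1]
  · simp [h0]

/-! ### Comparison of the rhombus with the square -/

/-- The reflection `(x₀, x₁) ↦ (-x₁, -x₀)`. -/
noncomputable def reflAnti : Plane ≃ₗᵢ[ℝ] Plane := Plane.refl 0 (-1) (by norm_num)

theorem reflAnti_zero (x : Plane) : reflAnti x 0 = -x 1 := by simp [reflAnti, Plane.refl_apply]

theorem reflAnti_one (x : Plane) : reflAnti x 1 = -x 0 := by simp [reflAnti, Plane.refl_apply]

theorem reflAnti_reflAnti (x : Plane) : reflAnti (reflAnti x) = x := by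
  ext i; fin_cases i <;> simp [reflAnti_zero, reflAnti_one]

theorem mem_centeredCell_self {c L : ℝ} (hc : 0 < c) (z : Plane) :
    z ∈ centeredCell c c L ↔ 0 < z 0 + z 1 ∧ 2 * z 0 < L := by
  simp only [centeredCell, Set.mem_ofPred_eq, ← mul_add, ← mul_sub, mul_pos_iff_of_pos_left hc,
    mul_lt_mul_iff_right₀ hc]
  refine and_congr_right fun h => and_iff_left_of_imp fun h' => by linarith

/-- The first cell and the mirror image of the second lie on opposite sides of the line b z₀ + a z₁
= 0. -/
theorem disjoint_centeredCell_reflAnti {a b L : ℝ} {z : Plane} (hz : z ∈ centeredCell a b L) :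
    reflAnti z ∉ centeredCell b a L := by
  intro h
  have h1 := hz.1
  have h2 := h.1
  rw [reflAnti_zero, reflAnti_one] at h2
  linarith

theorem centeredCell_subset_self {a b c L : ℝ} (hb : 0 ≤ b) (hba : b ≤ a) (hc : 0 < c)
    (hL : 0 < L) (h : L ^ 2 = a ^ 2 + b ^ 2) {z : Plane} (hz0 : z 0 + z 1 ≠ 0)
    (hz : z ∈ centeredCell a b L ∨ z ∈ centeredCell b a L) :
    z ∈ centeredCell c c L ∨ reflAnti z ∈ centeredCell c c L := by
  rw [mem_centeredCell_self hc, mem_centeredCell_self hc, reflAnti_zero, reflAnti_one]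
  have hz2 : 2 * z 0 < L := by
    rcases hz with hz | hz <;> exact hz.2.1
  rcases lt_or_gt_of_ne hz0 with hneg | hpos
  swap
  · exact Or.inl ⟨hpos, hz2⟩
  refine Or.inr ⟨by linarith, ?_⟩
  have ha : 0 < a := by
    rcases eq_or_lt_of_le hb with h0 | h0
    · rcases eq_or_lt_of_le (hb.trans hba) with h1 | h1
      · subst h0; subst h1; nlinarith
      · exact h1
    · linarith
  rcases hz with hz | hz
  -- If -2 z₁ ≥ L, then z₀ < -z₁ gives b z₀ + a z₁ ≤ (a - b) z₁ ≤ 0, against `h1`.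
  · have h1 := hz.1
    by_contra! hc2
    nlinarith [mul_nonneg hb (by linarith : 0 ≤ -z 1 - z 0),
      mul_nonneg (sub_nonneg.2 hba) (by linarith : 0 ≤ -z 1)]
  · have h1 := hz.1
    have h3 := hz.2.2
    by_contra! hc2
    -- The depth -z₁ stays below ab/L, the altitude of the right triangle with legs a, b on its
    -- hypotenuse; by AM-GM it is at most L/2.
    have e1 : L ^ 2 * (-z 1) < a * b * L := by
      nlinarith [mul_lt_mul_of_pos_left h3 ha, mul_le_mul_of_nonneg_left h1.le hb]
    have e2 : 2 * (a * b) ≤ L ^ 2 := by linarith [two_mul_le_add_sq a b]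
    nlinarith [mul_le_mul_of_nonneg_right e2 hL.le, mul_le_mul_of_nonneg_left hc2 (sq_nonneg L)]

/-- Under the integral a cell may be replaced by its mirror image. Pairing each cell with the mirror
image of the other, the indicators on the left sum to at most 1; those on the right sum to at least
1 wherever the left is nonzero, almost everywhere. -/
theorem lintegral_centeredCell_le {a b c L : ℝ} (hb : 0 ≤ b) (hba : b ≤ a) (hc : 0 < c)
    (hL : 0 < L) (h : L ^ 2 = a ^ 2 + b ^ 2) {F : ℝ → ℝ≥0∞} (hF : Measurable F) :
    (∫⁻ z, (centeredCell a b L).indicator (fun z => F ‖z‖) z) +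
        (∫⁻ z, (centeredCell b a L).indicator (fun z => F ‖z‖) z) ≤
      (∫⁻ z, (centeredCell c c L).indicator (fun z => F ‖z‖) z) +
        (∫⁻ z, (centeredCell c c L).indicator (fun z => F ‖z‖) z) := by
  have hm : ∀ a b, Measurable ((centeredCell a b L).indicator fun z => F ‖z‖) := fun a b =>
    (hF.comp measurable_norm).indicator (measurableSet_centeredCell _ _ _)
  have hdouble : ∀ a b a' b',
      2 * ((∫⁻ z, (centeredCell a b L).indicator (fun z => F ‖z‖) z) +
        (∫⁻ z, (centeredCell a' b' L).indicator (fun z => F ‖z‖) z)) =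
      ∫⁻ z, ((centeredCell a b L).indicator (fun z => F ‖z‖) z +
          (centeredCell a' b' L).indicator (fun z => F ‖z‖) (reflAnti z) +
        ((centeredCell a' b' L).indicator (fun z => F ‖z‖) z +
          (centeredCell a b L).indicator (fun z => F ‖z‖) (reflAnti z))) := by
    intro a b a' b'
    have hm' : ∀ a b, Measurable fun z =>
        (centeredCell a b L).indicator (fun z => F ‖z‖) (reflAnti z) := fun a b =>
      (hm a b).comp reflAnti.continuous.measurable
    have hadd := fun a b a' b' => (hm a b).add (hm' a' b')
    simp only [Pi.add_def] at hadd
    rw [lintegral_add_left (hadd _ _ _ _), lintegral_add_left (hm _ _),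
      lintegral_add_left (hm _ _), Plane.lintegral_comp_isometry, Plane.lintegral_comp_isometry]
    ring
  rw [← ENNReal.mul_le_mul_iff_right two_ne_zero ENNReal.ofNat_ne_top, hdouble, hdouble]
  refine lintegral_mono_ae ?_
  filter_upwards [Plane.ae_linear_ne 1 1 0 (by simp)] with z hz
  rw [one_mul, one_mul] at hz
  have hz' : reflAnti z 0 + reflAnti z 1 ≠ 0 := by
    rw [reflAnti_zero, reflAnti_one]; contrapose! hz; linarith
  have k1 := @disjoint_centeredCell_reflAnti a b L z
  have k2 := @disjoint_centeredCell_reflAnti b a L z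
  have k3 := centeredCell_subset_self hb hba hc hL h hz
  have k4 := centeredCell_subset_self hb hba hc hL h hz'
  rw [reflAnti_reflAnti] at k4
  simp only [Set.indicator, LinearIsometryEquiv.norm_map]
  by_cases hS : z ∈ centeredCell c c L ∨ reflAnti z ∈ centeredCell c c L
  · refine add_le_add ?_ ?_
    · trans F ‖z‖
      · split_ifs <;> simp_all
      · rcases hS with hS | hS <;> simp [hS]
    · trans F ‖z‖
      · split_ifs <;> simp_all
      · rcases hS with hS | hS <;> simp [hS]
  · have n1 : z ∉ centeredCell a b L := fun hh => hS (k3 (Or.inl hh))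
    have n2 : z ∉ centeredCell b a L := fun hh => hS (k3 (Or.inr hh))
    have n3 : reflAnti z ∉ centeredCell a b L := fun hh => hS (k4 (Or.inl hh)).symm
    have n4 : reflAnti z ∉ centeredCell b a L := fun hh => hS (k4 (Or.inr hh)).symm
    simp [n1, n2, n3, n4]

theorem lintegral_rhombus_le_square {a b c : ℝ} (ha : 0 ≤ a) (hb : 0 ≤ b) (hc : 0 ≤ c)
    (h : a ^ 2 + b ^ 2 = c ^ 2 + c ^ 2) {F : ℝ → ℝ≥0∞} (hF : Measurable F) :
    ∫⁻ x, F (nearDist (rhombus a b) x) ≤ ∫⁻ x, F (nearDist (rhombus c c) x) := by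
  rcases eq_or_lt_of_le hc with rfl | hc'
  · have ha' : a = 0 := by nlinarith [sq_nonneg a, sq_nonneg b]
    have hb' : b = 0 := by nlinarith [sq_nonneg a, sq_nonneg b]
    rw [ha', hb']
  have hL : 0 < √(a ^ 2 + b ^ 2) := Real.sqrt_pos.2 (by rw [h]; positivity)
  have hL2 : √(a ^ 2 + b ^ 2) ^ 2 = a ^ 2 + b ^ 2 := Real.sq_sqrt (by positivity)
  rw [lintegral_rhombus ha hb hL hL2 hF, lintegral_rhombus hc hc hL (hL2.trans h) hF]
  gcongr 4 * ?_
  rcases le_total b a with hba | hab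
  · exact lintegral_centeredCell_le hb hba hc' hL hL2 hF
  · exact (add_comm _ _).trans_le
      (lintegral_centeredCell_le ha hab hc' hL (by rw [hL2, add_comm]) hF)

/-! ### Normal form of orthogonal pairs and the two moves combined -/

theorem exists_isometry_apply_eq {u v : Plane} (h : ‖u‖ = ‖v‖) :
    ∃ T : Plane ≃ₗᵢ[ℝ] Plane, T u = v :=
  ⟨_, Submodule.reflection_sub h⟩

theorem lintegral_nearDist_isometry (T : Plane ≃ₗᵢ[ℝ] Plane) (u v : Plane) (F : ℝ → ℝ≥0∞) :
    ∫⁻ x, F (nearDist (T u, T v) x) = ∫⁻ x, F (nearDist (u, v) x) := by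
  rw [← Plane.lintegral_comp_isometry T]
  exact lintegral_congr fun x => by rw [nearDist_comp_isometry T (u, v)]

theorem lintegral_nearDist_of_orthogonal {u v : Plane} (h : inner ℝ u v = 0) (F : ℝ → ℝ≥0∞) :
    ∫⁻ x, F (nearDist (u, v) x) = ∫⁻ x, F (nearDist (rhombus ‖u‖ ‖v‖) x) := by
  have hfst : ∀ r : ℝ, 0 ≤ r → ‖(!₂[r, 0] : Plane)‖ = r := norm_axis_vector
  have hsnd : ∀ r : ℝ, 0 ≤ r → ‖(!₂[0, r] : Plane)‖ = r := fun r hr => by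
    rw [← sq_eq_sq₀ (norm_nonneg _) hr, Plane.norm_sq]; simp
  have hzero : (!₂[0, 0] : Plane) = 0 := by ext i; fin_cases i <;> simp
  -- When u = 0, orthogonality says nothing about v, so v itself is moved to the second axis.
  by_cases hu : u = 0
  · obtain ⟨T, hT⟩ := exists_isometry_apply_eq (hsnd _ (norm_nonneg v)).symm
    rw [← lintegral_nearDist_isometry T, hT, hu, map_zero, norm_zero, rhombus, hzero]
  · obtain ⟨T, hT⟩ := exists_isometry_apply_eq (hfst _ (norm_nonneg u)).symm
    rw [← lintegral_nearDist_isometry T, hT]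
    have h0 : T v 0 = 0 := by
      rw [← T.inner_map_map, hT, Plane.inner_eq] at h
      simpa [hu] using h
    have h1 : T v 1 ^ 2 = ‖v‖ ^ 2 := by
      rw [← T.norm_map, Plane.norm_sq, h0]; ring
    rcases sq_eq_sq_iff_eq_or_eq_neg.1 h1 with h1 | h1
    · have : T v = !₂[0, ‖v‖] := by ext i; fin_cases i <;> simp [h0, h1]
      rw [this, rhombus]
    · have : T v = -!₂[0, ‖v‖] := by ext i; fin_cases i <;> simp [h0, h1]
      simp_rw [this, rhombus, nearDist_neg_snd]

theorem lintegral_nearDist_le_of_orthogonal {u v v₁ v₂ : Plane} (huv : inner ℝ u v = 0)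
    (horth : inner ℝ v₁ v₂ = 0) (hlen : ‖v₁‖ = ‖v₂‖)
    (hE : ‖u‖ ^ 2 + ‖v‖ ^ 2 = ‖v₁‖ ^ 2 + ‖v₂‖ ^ 2) {F : ℝ → ℝ≥0∞} (hF : Measurable F) :
    ∫⁻ x, F (nearDist (u, v) x) ≤ ∫⁻ x, F (nearDist (v₁, v₂) x) := by
  rw [lintegral_nearDist_of_orthogonal huv, lintegral_nearDist_of_orthogonal horth, ← hlen]
  exact lintegral_rhombus_le_square (norm_nonneg _) (norm_nonneg _) (norm_nonneg _)
    (by rw [hE, ← hlen]) hF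

theorem lintegral_nearDist_le_of_antitone {u v v₁ v₂ : Plane}
    (horth : inner ℝ v₁ v₂ = 0) (hlen : ‖v₁‖ = ‖v₂‖)
    (hE : ‖u‖ ^ 2 + ‖v‖ ^ 2 = ‖v₁‖ ^ 2 + ‖v₂‖ ^ 2) {F : ℝ → ℝ≥0∞} (hF : Antitone F) :
    ∫⁻ x, F (nearDist (u, v) x) ≤ ∫⁻ x, F (nearDist (v₁, v₂) x) := by
  obtain ⟨v', h1, h2, h3⟩ := exists_orthogonal_norm_eq u v
  exact (h3 F hF).trans
    (lintegral_nearDist_le_of_orthogonal h1 horth hlen (by rw [h2, hE]) hF.measurable)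

/-! ### The Gaussian case and the theorem -/

/-- The Gaussian density. -/
noncomputable def gaussianDensity (x : Plane) : ℝ≥0∞ := ENNReal.ofReal (Real.exp (-‖x‖ ^ 2))

theorem isRadiallyNonincreasing_gaussianDensity : IsRadiallyNonincreasing gaussianDensity := by
  intro x y h
  unfold gaussianDensity
  gcongr

theorem measurable_gaussianDensity : Measurable gaussianDensity :=
  ENNReal.measurable_ofReal.comp (Continuous.measurable (by fun_prop))

theorem lintegral_gaussianDensity_ne_top : ∫⁻ x, gaussianDensity x ≠ ∞ := by
  have h : Integrable fun x : Plane => Real.exp (-‖x‖ ^ 2) := by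
    -- A non-integrable function would have integral 0 by convention, but the Gaussian integral is
    -- positive.
    by_contra hn
    have h1 := GaussianFourier.integral_rexp_neg_mul_sq_norm (V := Plane) one_pos
    simp only [neg_mul, one_mul] at h1
    rw [integral_undef hn] at h1
    have : 0 < (Real.pi / 1) ^ (Module.finrank ℝ Plane / 2 : ℝ) := by positivity
    linarith
  exact (h.lintegral_lt_top).ne

theorem gaussianP_eq_toReal_densityP {N : ℕ} [NeZero N] (v : Fin N → Plane) :
    gaussianP v = (densityP gaussianDensity v).toReal := by
  unfold gaussianP densityP
  rw [integral_eq_lintegral_of_nonneg_ae]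
  · congr 1
    refine lintegral_congr fun x => ?_
    refine le_antisymm ?_ (iSup_le fun i => ENNReal.ofReal_le_ofReal ?_)
    · obtain ⟨i, hi⟩ := exists_eq_ciSup_of_finite (f := fun i => Real.exp (-‖x - v i‖ ^ 2))
      rw [← hi]
      exact le_iSup (fun i => gaussianDensity (x - v i)) i
    · exact le_ciSup (f := fun i => Real.exp (-‖x - v i‖ ^ 2)) (Set.finite_range _).bddAbove i
  · exact Filter.Eventually.of_forall fun x => Real.iSup_nonneg fun i => (Real.exp_pos _).le
  · exact (Measurable.iSup fun i => Continuous.measurable (by fun_prop)).aestronglyMeasurable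

theorem densityP_ne_top {N : ℕ} {f : Plane → ℝ≥0∞} (hm : Measurable f) (hf : ∫⁻ x, f x ≠ ∞)
    (v : Fin N → Plane) : densityP f v ≠ ∞ := by
  have h : densityP f v ≤ ∑ i, ∫⁻ x, f (x - v i) := by
    have hmi : ∀ i, Measurable fun x => f (x - v i) := fun i =>
      hm.comp (measurable_id.sub_const (v i))
    rw [← lintegral_finsetSum _ fun i _ => hmi i]
    exact lintegral_mono fun x => iSup_le fun i =>
      Finset.single_le_sum (f := fun i => f (x - v i)) (fun _ _ => zero_le) (Finset.mem_univ i)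
  refine ne_top_of_le_ne_top ?_ h
  simp_rw [lintegral_sub_right_eq_self]
  exact ENNReal.sum_ne_top.2 fun _ _ => hf

theorem mainTheorem2 (E : ℝ) (v₁ v₂ : EuclideanSpace ℝ (Fin 2))
    (horth : inner ℝ v₁ v₂ = 0) (hlen : ‖v₁‖ = ‖v₂‖) (hE : ‖v₁‖ ^ 2 + ‖v₂‖ ^ 2 = E) :
    -- the Gaussian density
    IsMaxOn (fun w => gaussianP (antipodal w))
      {w : EuclideanSpace ℝ (Fin 2) × EuclideanSpace ℝ (Fin 2) | ‖w.1‖ ^ 2 + ‖w.2‖ ^ 2 = E}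
      (v₁, v₂) ∧
    -- every radially symmetric nonincreasing density
    (∀ f : EuclideanSpace ℝ (Fin 2) → ℝ≥0∞, Measurable f → IsRadiallyNonincreasing f →
      IsMaxOn (fun w => densityP f (antipodal w))
        {w : EuclideanSpace ℝ (Fin 2) × EuclideanSpace ℝ (Fin 2) | ‖w.1‖ ^ 2 + ‖w.2‖ ^ 2 = E}
        (v₁, v₂) ∧
      IsMaxOn (fun w => voronoiP f (antipodal w))
        {w : EuclideanSpace ℝ (Fin 2) × EuclideanSpace ℝ (Fin 2) | ‖w.1‖ ^ 2 + ‖w.2‖ ^ 2 = E}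
        (v₁, v₂)) ∧
    -- every radially symmetric density, among the orthogonal pairs
    (∀ f : EuclideanSpace ℝ (Fin 2) → ℝ≥0∞, Measurable f → IsRadial f →
      IsMaxOn (fun w => voronoiP f (antipodal w))
        {w : EuclideanSpace ℝ (Fin 2) × EuclideanSpace ℝ (Fin 2) |
          inner ℝ w.1 w.2 = 0 ∧ ‖w.1‖ ^ 2 + ‖w.2‖ ^ 2 = E}
        (v₁, v₂)) := by
  have hdensity : ∀ f : Plane → ℝ≥0∞, IsRadiallyNonincreasing f → ∀ w : Plane × Plane,
      ‖w.1‖ ^ 2 + ‖w.2‖ ^ 2 = E →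
      densityP f (antipodal w) ≤ densityP f (antipodal (v₁, v₂)) := by
    intro f hf w hw
    rw [densityP_antipodal hf, densityP_antipodal hf]
    exact lintegral_nearDist_le_of_antitone horth hlen (hw.trans hE.symm)
      (antitone_radialProfile hf)
  refine ⟨fun w hw => ?_, fun f hm hf => ⟨fun w hw => hdensity f hf w hw, fun w hw => ?_⟩,
    fun f hm hf w hw => ?_⟩
  · change gaussianP (antipodal w) ≤ gaussianP (antipodal (v₁, v₂))
    rw [gaussianP_eq_toReal_densityP, gaussianP_eq_toReal_densityP]
    exact ENNReal.toReal_mono (densityP_ne_top measurable_gaussianDensity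
      lintegral_gaussianDensity_ne_top _)
      (hdensity _ isRadiallyNonincreasing_gaussianDensity w hw)
  · change voronoiP f (antipodal w) ≤ voronoiP f (antipodal (v₁, v₂))
    rw [voronoiP_antipodal hm hf.isRadial, voronoiP_antipodal hm hf.isRadial]
    exact lintegral_nearDist_le_of_antitone horth hlen (Eq.trans hw hE.symm)
      (antitone_radialProfile hf)
  · change voronoiP f (antipodal w) ≤ voronoiP f (antipodal (v₁, v₂))
    rw [voronoiP_antipodal hm hf, voronoiP_antipodal hm hf]
    exact lintegral_nearDist_le_of_orthogonal hw.1 horth hlen (hw.2.trans hE.symm)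
      (measurable_radialProfile hm)
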